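/- Let $(A,\mathfrak m)$ be a Noetherian local ring and $M$ a finitely generated $A$-module. Let $\underline a=a_1,\dots,a_d\in\mathfrak m$ be a system of parameters of $M$, that is, $d=\dim_A M$ and $M/\underline aM$ has finite length. Let $\mathfrak q\supseteq \underline aA$ be an ideal of $A$ and let $c_1,\dots,c_d\ge 0$ be integers with $a_i\in\mathfrak q^{c_i}$ for $i=1,\dots,d$. For $n\in\mathbb N$ let $K_\bullet(\underline a,\mathfrak q,M;n)$ be the subcomplex of the Koszul complex $K_\bullet(\underline a;M)$ with terms $$K_i(\underline a,\mathfrak q,M;n)=\bigoplus_{1\le j_1<\dots<j_i\le d}\mathfrak q^{\,n-c_{j_1}-\dots-c_{j_i}}M ,\qquad 0\le i\le d,$$ where $\mathfrak q^{k}=A$ for $k\le 0$, and with the boundary maps of $K_\bullet(\underline a;M)$ restricted to these terms. For a complex $X: 0\to X_d\to\dots\to X_0\to 0$ of $A$-modules with homology of finite length put $\chi_A(X)=\sum_{i=0}^d(-1)^i\ell_A(H_i(X))$. For an ideal $I$ such that $M/I^nM$ has finite length for all $n\gg0$ and its length is given for all $n\gg 0$ by a polynomial in $n$ (the Hilbert--Samuel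 polynomial), let $e_0(I;M)$ be $d!$ times the coefficient of $n^d$ in that polynomial (so $e_0(\mathfrak q;M)=0$ if $\mathfrak q=A$). Then the Hilbert--Samuel polynomials of $M$ with respect to $\underline aA$ and $\mathfrak q$ exist, all homology modules of $K_\bullet(\underline a,\mathfrak q,M;n)$ have finite length for every $n\in\mathbb N$, and $$e_0(\underline a;M)=c_1\cdots c_d\,e_0(\mathfrak q;M)+\chi_A\big(K_\bullet(\underline a,\mathfrak q,M;n)\big)\qquad\text{for all } n\gg 0,$$ where $e_0(\underline a;M)=e_0(\underline aA;M)$. In particular, the Euler characteristic $\chi_A(K_\bullet(\underline a,\mathfrak q,M;n))$ is constant for all $n\gg 0$. -/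

import Mathlib

namespace GenKoszul

universe u v

section Koszul

variable {A : Type u} [CommRing A] {t : ℕ}

/-- The subsets `{j₁ < ⋯ < jᵢ}` of the index set of the system `a₁, …, aₜ`. -/
abbrev Idx (t i : ℕ) : Type := {J : Finset (Fin t) // J.card = i}

/-- `J ∪ {k}` for `k ∉ J`. -/
def Idx.insert {i : ℕ} (J : Idx t i) (k : {k : Fin t // k ∉ J.1}) : Idx t (i + 1) :=
  ⟨Insert.insert k.1 J.1, by rw [Finset.card_insert_of_notMem k.2, J.2]⟩

/-- The sign with which `e_J` occurs in the boundary of `e_{J ∪ {k}}`: it is `(-1)^(p+1)` if `k` is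
the `p`-th smallest element of `J ∪ {k}`, that is, `(-1)` to the number of elements of `J` below
`k`. -/
def sgn (J : Finset (Fin t)) (k : Fin t) : ℤ := (-1) ^ (J.filter (· < k)).card

/-- The Koszul boundary map `K_{i+1}(a; M) → K_i(a; M)`, where `K_i(a; M) = ⨁_{|J| = i} M` is
written as the module of families `(x_J)`. It sends `x · e_{j₁} ∧ ⋯ ∧ e_{jᵢ₊₁}` to
`∑ₖ (-1)^(k+1) a_{jₖ} x · e_{j₁} ∧ ⋯ ∧ ê_{jₖ} ∧ ⋯ ∧ e_{jᵢ₊₁}`. -/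
def koszulD (a : Fin t → A) (M : Type v) [AddCommGroup M] [Module A M] (i : ℕ) :
    (Idx t (i + 1) → M) →ₗ[A] (Idx t i → M) :=
  LinearMap.pi fun J => ∑ k : {k : Fin t // k ∉ J.1},
    (sgn J.1 k.1 • a k.1) • LinearMap.proj (J.insert k)

variable {M : Type v} [AddCommGroup M] [Module A M]

lemma koszulD_apply (a : Fin t → A) (i : ℕ) (x : Idx t (i + 1) → M) (J : Idx t i) :
    koszulD a M i x J =
      ∑ k : {k : Fin t // k ∉ J.1}, (sgn J.1 k.1 • a k.1) • x (J.insert k) := by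
  simp [koszulD]

lemma sgn_mul_sgn_insert (J : Finset (Fin t)) {k l : Fin t} (hk : k ∉ J) (hl : l ∉ J)
    (hkl : k ≠ l) :
    sgn J k * sgn (Insert.insert k J) l = - (sgn J l * sgn (Insert.insert l J) k) := by
  unfold sgn
  rcases lt_or_gt_of_ne hkl with h | h
  · rw [Finset.filter_insert, Finset.filter_insert, if_pos h, if_neg (not_lt.mpr h.le),
      Finset.card_insert_of_notMem (by simp [hk])]
    ring
  · rw [Finset.filter_insert, Finset.filter_insert, if_neg (not_lt.mpr h.le), if_pos h,
      Finset.card_insert_of_notMem (by simp [hl])]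
    ring

lemma koszulD_comp_koszulD (a : Fin t → A) (i : ℕ) (x : Idx t (i + 2) → M) :
    koszulD a M i (koszulD a M (i + 1) x) = 0 := by
  funext J
  let y : Finset (Fin t) → M := fun S => if h : S.card = i + 2 then x ⟨S, h⟩ else 0
  let g : Fin t → Fin t → M := fun k l =>
    if k ∉ J.1 ∧ l ∉ J.1 ∧ k ≠ l then
      ((sgn J.1 k * sgn (Insert.insert k J.1) l : ℤ) • (a k * a l)) •
        y (Insert.insert l (Insert.insert k J.1)) else 0
  have hg : ∀ k l, g k l = - g l k := by
    intro k l
    simp only [g]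
    by_cases h : k ∉ J.1 ∧ l ∉ J.1 ∧ k ≠ l
    · rw [if_pos h, if_pos ⟨h.2.1, h.1, h.2.2.symm⟩,
        sgn_mul_sgn_insert J.1 h.1 h.2.1 h.2.2, Finset.insert_comm, mul_comm (a k), neg_smul,
        neg_smul]
    · rw [if_neg h, if_neg (fun h' => h ⟨h'.2.1, h'.1, h'.2.2.symm⟩), neg_zero]
  have hsum : koszulD a M i (koszulD a M (i + 1) x) J = ∑ k, ∑ l, g k l := by
    rw [koszulD_apply]
    have h1 : ∀ k : Fin t, k ∈ J.1 → ∑ l, g k l = 0 := fun k hk =>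
      Finset.sum_eq_zero fun l _ => if_neg fun h => h.1 hk
    rw [← Fintype.sum_subtype_add_sum_subtype (fun k => k ∉ J.1) (fun k => ∑ l, g k l)]
    rw [Finset.sum_eq_zero (s := (Finset.univ : Finset {k // ¬ k ∉ J.1}))
      (fun k _ => h1 k.1 (not_not.mp k.2)), add_zero]
    refine Finset.sum_congr rfl fun k _ => ?_
    rw [koszulD_apply, Finset.smul_sum,
      ← Fintype.sum_subtype_add_sum_subtype (fun l => l ∉ (J.insert k).1) (fun l => g k.1 l)]
    rw [Finset.sum_eq_zero (s := (Finset.univ : Finset {l // ¬ l ∉ (J.insert k).1}))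
      (fun l _ => if_neg fun h => ?_), add_zero]
    · refine Finset.sum_congr rfl fun l _ => ?_
      have hl : l.1 ≠ k.1 ∧ l.1 ∉ J.1 := by
        have := l.2
        simpa [Idx.insert] using this
      have hy : y (Insert.insert l.1 (Insert.insert k.1 J.1)) = x ((J.insert k).insert l) :=
        dif_pos ((J.insert k).insert l).2
      simp only [g]
      rw [if_pos ⟨k.2, hl.2, hl.1.symm⟩, hy, smul_smul, smul_mul_smul_comm]
      rfl
    · have := l.2
      simp only [Idx.insert, Finset.mem_insert, not_not] at this
      rcases this with h' | h'
      · exact h.2.2 h'.symm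
      · exact h.2.1 h'
  have h0 : ∑ k, ∑ l, g k l = 0 := by
    classical
    have hdiag : ∀ k, g k k = 0 := fun k => if_neg fun h => h.2.2 rfl
    rw [← Finset.sum_product']
    refine Finset.sum_involution (fun p _ => (p.2, p.1)) ?_ ?_ ?_ ?_
    · intro p _
      rw [hg p.1 p.2]
      exact neg_add_cancel _
    · rintro ⟨k, l⟩ _ hne heq
      simp only [Prod.mk.injEq] at heq
      obtain ⟨rfl, -⟩ := heq
      exact hne (hdiag _)
    · intro p _
      simp
    · intro p _
      rfl
  rw [hsum, h0]
  rfl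

/-- `K_i(a, q, M; n) = ⨁_{j₁ < ⋯ < jᵢ} q^(n - c_{j₁} - ⋯ - c_{jᵢ}) M`, a submodule of `K_i(a; M)`.
The subtraction is truncated: powers of `q` with non-positive exponent are the unit ideal. -/
def genKoszulX (q : Ideal A) (c : Fin t → ℕ) (M : Type v) [AddCommGroup M] [Module A M]
    (n i : ℕ) : Submodule A (Idx t i → M) :=
  Submodule.pi Set.univ fun J => q ^ (n - ∑ j ∈ J.1, c j) • (⊤ : Submodule A M)

lemma koszulD_mem {a : Fin t → A} {q : Ideal A} {c : Fin t → ℕ} (ha : ∀ i, a i ∈ q ^ c i)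
    (n i : ℕ) {x : Idx t (i + 1) → M} (hx : x ∈ genKoszulX q c M n (i + 1)) :
    koszulD a M i x ∈ genKoszulX q c M n i := by
  intro J _
  rw [koszulD_apply]
  refine Submodule.sum_mem _ fun k _ => ?_
  have h1 := hx (J.insert k) trivial
  have h2 : sgn J.1 k.1 • a k.1 ∈ q ^ c k.1 := zsmul_mem (ha k.1) _
  have h3 := Submodule.smul_mem_smul h2 h1
  rw [← Submodule.mul_smul, ← pow_add] at h3
  refine Submodule.smul_mono_left (Ideal.pow_le_pow_right ?_) h3
  have : ∑ j ∈ (J.insert k).1, c j = c k.1 + ∑ j ∈ J.1, c j :=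
    Finset.sum_insert k.2
  omega

/-- The generalized Koszul complex `K_•(a, q, M; n)`, where `aᵢ ∈ q^(cᵢ)`: the subcomplex of the
Koszul complex `K_•(a; M)` with terms `genKoszulX` and the restricted Koszul boundary maps. -/
noncomputable def genKoszulComplex (a : Fin t → A) (q : Ideal A) (c : Fin t → ℕ)
    (ha : ∀ i, a i ∈ q ^ c i) (M : Type v) [AddCommGroup M] [Module A M] (n : ℕ) :
    ChainComplex (ModuleCat.{v} A) ℕ :=
  ChainComplex.of (fun i => ModuleCat.of A (genKoszulX q c M n i))
    (fun i => ModuleCat.ofHom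
      ((koszulD a M i).restrict fun _ hx => koszulD_mem ha n i hx))
    (fun i => by
      ext x : 2
      exact Subtype.ext (koszulD_comp_koszulD a i x.1))

end Koszul

/-- The Euler characteristic `χ_A(X) = ∑_{i=0}^N (-1)^i ℓ_A(H_i(X))` of a complex
`X : 0 → X_N → ⋯ → X_1 → X_0 → 0` whose homology modules have finite length. -/
noncomputable def eulerChar {A : Type u} [CommRing A] (N : ℕ)
    (X : ChainComplex (ModuleCat.{v} A) ℕ) : ℤ :=
  ∑ i ∈ Finset.range (N + 1), (-1) ^ i * ((Module.length A (X.homology i)).toNat : ℤ)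

section Multiplicity

variable {A : Type u} [CommRing A] (I : Ideal A) (M : Type v) [AddCommGroup M] [Module A M]

/-- `P` is the Hilbert-Samuel polynomial of `M` with respect to `I`: for all `n ≫ 0` the module
`M / Iⁿ M` has finite length, equal to `P(n)`. -/
def IsHilbertSamuelPoly (P : Polynomial ℚ) : Prop :=
  ∀ᶠ n : ℕ in Filter.atTop, ∃ l : ℕ,
    Module.length A (M ⧸ (I ^ n • (⊤ : Submodule A M))) = l ∧ (l : ℚ) = P.eval (n : ℚ)

open Classical in
/-- The Hilbert-Samuel polynomial of `M` with respect to `I` (it is unique when it exists; `0` is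
only a default value). -/
noncomputable def hilbertSamuelPoly : Polynomial ℚ :=
  if h : ∃ P : Polynomial ℚ, IsHilbertSamuelPoly I M P then h.choose else 0

/-- The Hilbert-Samuel multiplicity `e₀(I; M)`: with `d = dim_A M`, it is `d!` times the coefficient
of `n^d` in the Hilbert-Samuel polynomial, that is, the integer `e₀` in
`e₀ * (n+d choose d) + e₁ * (n+d-1 choose d-1) + ⋯ + e_d`. -/
noncomputable def multiplicity : ℚ :=
  (((Module.supportDim A M).unbotD 0).toNat.factorial : ℚ) *
    (hilbertSamuelPoly I M).coeff ((Module.supportDim A M).unbotD 0).toNat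

end Multiplicity

/-- `a₁, …, a_d` is a system of parameters of the module `M` over the local ring `A`: the elements
lie in the maximal ideal, `d = dim_A M`, and `M / (a₁, …, a_d) M` has finite length. -/
structure IsSystemOfParameters {A : Type u} [CommRing A] [IsLocalRing A] {d : ℕ} (a : Fin d → A)
    (M : Type v) [AddCommGroup M] [Module A M] : Prop where
  mem_maximalIdeal : ∀ i, a i ∈ IsLocalRing.maximalIdeal A
  dim_eq : Module.supportDim A M = (d : WithBot ℕ∞)
  finite_length : IsFiniteLength A (M ⧸ (Ideal.span (Set.range a) • (⊤ : Submodule A M)))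

end GenKoszul

/-! Write `K(n)` for the generalized complex; `K(0)` is the full Koszul complex. Euler
characteristics are additive, so `χ(K(0)) - χ(K(n))` is the alternating sum over subsets `J` of the
lengths of `M / q^(n - c_J) M`, where `c_J` is the sum of the `c_j` over `J`
(`eulerChar_koszul_eq`). For large `n` this is an iterated difference, with steps `c_j`, of the
Hilbert-Samuel polynomial of `q`. That polynomial has degree at most `d`, so the difference is `c_1
⋯ c_d · e₀(q; M)` (`sum_powerset_eval_sub_sum`).

For `q = (a)` and `c = 1`, Artin-Rees and the relation `D(e_j ∧ z) = a_j z` on cycles make `K(n)`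
exact for large `n`, so `χ(K(0)) = e₀(a; M)`; combining the two cases gives the formula. The same
vanishing yields the Hilbert-Samuel polynomial itself: a `t`-th difference of the length function is
eventually constant. The relation on cycles also shows that `(a)` kills the homology, whence finite
length. -/

namespace GenKoszul

universe u v

/-! ### Lengths of subquotients. -/

section RelLength

variable {A : Type*} [CommRing A] {M N : Type*} [AddCommGroup M] [Module A M]
  [AddCommGroup N] [Module A N]

/-- The length of `Q / P` for submodules `P ≤ Q`. -/
noncomputable def relLength (P Q : Submodule A M) : ℕ∞ :=
  Module.length A (Q ⧸ P.submoduleOf Q)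

lemma relLength_add {P Q R : Submodule A M} (hPQ : P ≤ Q) (hQR : Q ≤ R) :
    relLength P R = relLength P Q + relLength Q R := by
  refine Module.length_eq_add_of_exact
    (Submodule.mapQ (P.submoduleOf Q) (P.submoduleOf R) (Submodule.inclusion hQR)
      fun x hx => hx)
    (Submodule.factor (p := P.submoduleOf R) (p' := Q.submoduleOf R) fun x hx => hPQ hx)
    ?_ (Submodule.factor_surjective _) ?_
  · rw [← LinearMap.ker_eq_bot, LinearMap.ker_eq_bot']
    intro x hx
    obtain ⟨x, rfl⟩ := Submodule.Quotient.mk_surjective _ x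
    have hx' : Submodule.inclusion hQR x ∈ P.submoduleOf R :=
      (Submodule.Quotient.mk_eq_zero _).1 hx
    exact (Submodule.Quotient.mk_eq_zero _).2 hx'
  · intro x
    obtain ⟨x, rfl⟩ := Submodule.Quotient.mk_surjective _ x
    constructor
    · intro h
      replace h : x ∈ Q.submoduleOf R := (Submodule.Quotient.mk_eq_zero _).1 h
      exact ⟨Submodule.Quotient.mk ⟨x.1, h⟩, rfl⟩
    · rintro ⟨y, hy⟩
      obtain ⟨y, rfl⟩ := Submodule.Quotient.mk_surjective _ y
      rw [← hy]
      exact (Submodule.Quotient.mk_eq_zero _).2 y.2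

lemma relLength_eq_zero_of_le {P Q : Submodule A M} (h : Q ≤ P) : relLength P Q = 0 := by
  rw [relLength, Module.length_eq_zero_iff, Submodule.submoduleOf_eq_top.2 h]
  infer_instance

lemma relLength_top (P : Submodule A M) : relLength P ⊤ = Module.length A (M ⧸ P) := by
  refine LinearEquiv.length_eq (Submodule.Quotient.equiv _ _ Submodule.topEquiv ?_)
  ext x
  simp [Submodule.submoduleOf]

/-- Applied to a differential, this splits the length of a term into a contribution from cycles and
one from boundaries. -/
lemma relLength_inf_ker_add_relLength_map (f : M →ₗ[A] N) {P Q : Submodule A M} (hPQ : P ≤ Q) :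
    relLength P Q = relLength (P ⊓ LinearMap.ker f) (Q ⊓ LinearMap.ker f) +
      relLength (P.map f) (Q.map f) := by
  refine Module.length_eq_add_of_exact
    (Submodule.mapQ ((P ⊓ LinearMap.ker f).submoduleOf (Q ⊓ LinearMap.ker f)) (P.submoduleOf Q)
      (Submodule.inclusion inf_le_left) fun x hx => hx.1)
    (Submodule.mapQ (P.submoduleOf Q) ((P.map f).submoduleOf (Q.map f))
      (f.restrict fun x hx => Submodule.mem_map_of_mem hx)
      fun x hx => Submodule.mem_map_of_mem (f := f) hx)
    ?_ ?_ ?_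
  · rw [← LinearMap.ker_eq_bot, LinearMap.ker_eq_bot']
    intro x hx
    obtain ⟨x, rfl⟩ := Submodule.Quotient.mk_surjective _ x
    have hx' : x.1 ∈ P := (Submodule.Quotient.mk_eq_zero (P.submoduleOf Q)).1 hx
    exact (Submodule.Quotient.mk_eq_zero _).2 ⟨hx', x.2.2⟩
  · intro x
    obtain ⟨⟨_, x, hx, rfl⟩, rfl⟩ := Submodule.Quotient.mk_surjective _ x
    exact ⟨Submodule.Quotient.mk ⟨x, hx⟩, rfl⟩
  · intro x
    obtain ⟨x, rfl⟩ := Submodule.Quotient.mk_surjective _ x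
    constructor
    · intro h
      have h' : f x.1 ∈ P.map f :=
        (Submodule.Quotient.mk_eq_zero ((P.map f).submoduleOf (Q.map f))).1 h
      obtain ⟨y, hy, hyx⟩ := h'
      refine ⟨Submodule.Quotient.mk ⟨x.1 - y, Q.sub_mem x.2 (hPQ hy), ?_⟩, ?_⟩
      · change f (x.1 - y) = 0
        rw [map_sub, hyx, sub_self]
      · refine (Submodule.Quotient.eq (P.submoduleOf Q)).2 ?_
        change x.1 - y - x.1 ∈ P
        simpa using hy
    · rintro ⟨y, hy⟩
      obtain ⟨y, rfl⟩ := Submodule.Quotient.mk_surjective _ y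
      rw [← hy]
      refine (Submodule.Quotient.mk_eq_zero _).2 ?_
      change f y.1 ∈ P.map f
      rw [LinearMap.mem_ker.1 y.2.2]
      exact zero_mem _

end RelLength

/-! ### Additivity of the Euler characteristic. -/

section Subcomplex

variable {A : Type*} [CommRing A] {F : ℕ → Type*} [∀ i, AddCommGroup (F i)]
  [∀ i, Module A (F i)] (D : ∀ i, F (i + 1) →ₗ[A] F i)

/-- The cycles of the subcomplex with terms `G i` of the complex `(F, D)`. -/
def subCycles (G : ∀ i, Submodule A (F i)) : ∀ i, Submodule A (F i)
  | 0 => G 0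
  | i + 1 => G (i + 1) ⊓ LinearMap.ker (D i)

/-- The boundaries of the subcomplex with terms `G i` of the complex `(F, D)`. -/
def subBoundaries (G : ∀ i, Submodule A (F i)) (i : ℕ) : Submodule A (F i) :=
  (G (i + 1)).map (D i)

/-- The lengths of the homology modules of the subcomplex with terms `G i` of `(F, D)`. -/
noncomputable def homologyLength (G : ∀ i, Submodule A (F i)) (i : ℕ) : ℕ∞ :=
  relLength (subBoundaries D G i) (subCycles D G i)

variable {D}

lemma subCycles_le (G : ∀ i, Submodule A (F i)) (i : ℕ) : subCycles D G i ≤ G i := by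
  cases i with
  | zero => exact le_rfl
  | succ i => exact inf_le_left

lemma subCycles_mono {G H : ∀ i, Submodule A (F i)} (h : ∀ i, G i ≤ H i) (i : ℕ) :
    subCycles D G i ≤ subCycles D H i := by
  cases i with
  | zero => exact h 0
  | succ i => exact inf_le_inf_right _ (h _)

lemma subBoundaries_mono {G H : ∀ i, Submodule A (F i)} (h : ∀ i, G i ≤ H i) (i : ℕ) :
    subBoundaries D G i ≤ subBoundaries D H i :=
  Submodule.map_mono (h _)

lemma subBoundaries_le_subCycles (hD : ∀ i x, D i (D (i + 1) x) = 0)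
    {G : ∀ i, Submodule A (F i)} (hG : ∀ i x, x ∈ G (i + 1) → D i x ∈ G i) (i : ℕ) :
    subBoundaries D G i ≤ subCycles D G i := by
  rintro _ ⟨x, hx, rfl⟩
  cases i with
  | zero => exact hG 0 x hx
  | succ i => exact ⟨hG _ x hx, hD i x⟩

/-- The Euler characteristics of a complex and of a subcomplex with quotients of finite length
differ by the alternating sum of the lengths of the quotients. -/
theorem sum_homologyLength_eq (hD : ∀ i x, D i (D (i + 1) x) = 0)
    {G H : ∀ i, Submodule A (F i)} (hG : ∀ i x, x ∈ G (i + 1) → D i x ∈ G i)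
    (hH : ∀ i x, x ∈ H (i + 1) → D i x ∈ H i) (hGH : ∀ i, G i ≤ H i)
    (hfin : ∀ i, relLength (G i) (H i) ≠ ⊤) (hGfin : ∀ i, homologyLength D G i ≠ ⊤)
    (t : ℕ) (ht : H (t + 1) ≤ G (t + 1)) :
    ∑ i ∈ Finset.range (t + 1), (-1 : ℤ) ^ i * ((homologyLength D H i).toNat : ℤ) =
      ∑ i ∈ Finset.range (t + 1), (-1 : ℤ) ^ i * ((homologyLength D G i).toNat : ℤ) +
      ∑ i ∈ Finset.range (t + 1), (-1 : ℤ) ^ i * ((relLength (G i) (H i)).toNat : ℤ) := by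
  set z : ℕ → ℕ∞ := fun i => relLength (subCycles D G i) (subCycles D H i) with hz
  set b : ℕ → ℕ∞ := fun i => relLength (subBoundaries D G i) (subBoundaries D H i) with hb
  -- Two chains from the boundaries of `G` to the cycles of `H`: through the boundaries of `H` and
  -- through the cycles of `G`.
  have h1 (i : ℕ) : b i + homologyLength D H i = homologyLength D G i + z i :=
    (relLength_add (subBoundaries_mono hGH i) (subBoundaries_le_subCycles hD hH i)).symm.trans
      (relLength_add (subBoundaries_le_subCycles hD hG i) (subCycles_mono hGH i))
  have h2 (i : ℕ) : relLength (G (i + 1)) (H (i + 1)) = z (i + 1) + b i :=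
    relLength_inf_ker_add_relLength_map (D i) (hGH (i + 1))
  have hzfin (i : ℕ) : z i ≠ ⊤ := by
    cases i with
    | zero => exact hfin 0
    | succ i =>
      intro h
      exact hfin (i + 1) (by rw [h2, h, top_add])
  have hbfin (i : ℕ) : b i ≠ ⊤ := by
    intro h
    exact hfin (i + 1) (by rw [h2, h, add_top])
  have hHfin (i : ℕ) : homologyLength D H i ≠ ⊤ := by
    intro h
    have := h1 i
    rw [h, add_top, eq_comm, ENat.add_eq_top] at this
    exact this.elim (hGfin i) (hzfin i)
  have h1' (i : ℕ) : ((b i).toNat : ℤ) + (homologyLength D H i).toNat =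
      (homologyLength D G i).toNat + (z i).toNat := by
    have := congrArg ENat.toNat (h1 i)
    rw [ENat.toNat_add (hbfin i) (hHfin i), ENat.toNat_add (hGfin i) (hzfin i)] at this
    exact_mod_cast this
  have h2' (i : ℕ) : ((relLength (G (i + 1)) (H (i + 1))).toNat : ℤ) =
      (z (i + 1)).toNat + (b i).toNat := by
    rw [h2, ENat.toNat_add (hzfin _) (hbfin _)]
    push_cast
    rfl
  -- Truncating at degree `m` leaves the single uncancelled term `b m`, which `ht` kills for `m =
  -- t`.
  have key (m : ℕ) :
      ∑ i ∈ Finset.range (m + 1), (-1 : ℤ) ^ i * ((homologyLength D H i).toNat : ℤ) =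
        ∑ i ∈ Finset.range (m + 1), (-1 : ℤ) ^ i * ((homologyLength D G i).toNat : ℤ) +
        ∑ i ∈ Finset.range (m + 1), (-1 : ℤ) ^ i * ((relLength (G i) (H i)).toNat : ℤ) -
        (-1) ^ m * (b m).toNat := by
    induction m with
    | zero =>
      have h0 : ((relLength (G 0) (H 0)).toNat : ℤ) = (z 0).toNat := rfl
      have := h1' 0
      simp only [zero_add, Finset.sum_range_one, pow_zero, one_mul]
      linarith
    | succ m ih =>
      rw [Finset.sum_range_succ, Finset.sum_range_succ _ (m + 1),
        Finset.sum_range_succ _ (m + 1), ih, h2', pow_succ]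
      linear_combination (-1 : ℤ) ^ m * (-1) * h1' (m + 1)
  have hbt : b t = 0 := relLength_eq_zero_of_le (Submodule.map_mono ht)
  rw [key t, hbt]
  simp

end Subcomplex

/-! ### Finite length criteria. -/

section FiniteLength

variable {A : Type*} [CommRing A] {M : Type*} [AddCommGroup M] [Module A M]

lemma span_smul_le_of_forall {ι : Type*} {a : ι → A} {P Q : Submodule A M}
    (h : ∀ j, ∀ x ∈ P, a j • x ∈ Q) : Ideal.span (Set.range a) • P ≤ Q := by
  rw [Submodule.smul_le]
  intro r hr x hx
  induction hr using Submodule.span_induction with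
  | mem r hr =>
    obtain ⟨j, rfl⟩ := hr
    exact h j x hx
  | zero => simp
  | add r s _ _ hr hs =>
    rw [add_smul]
    exact add_mem hr hs
  | smul r s _ hs =>
    rw [smul_assoc]
    exact Q.smul_mem r hs

lemma length_quotient_ne_top_of_le {P Q : Submodule A M} (h : P ≤ Q)
    (hP : Module.length A (M ⧸ P) ≠ ⊤) : Module.length A (M ⧸ Q) ≠ ⊤ :=
  ne_top_of_le_ne_top hP
    (Module.length_le_of_surjective (Submodule.factor h) (Submodule.factor_surjective h))

/-- If `M / IM` has finite length, then so do all the `M / IⁿM`. -/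
lemma length_quotient_pow_smul_ne_top [IsNoetherianRing A] (I : Ideal A)
    (h : Module.length A (M ⧸ (I • (⊤ : Submodule A M))) ≠ ⊤) (n : ℕ) :
    Module.length A (M ⧸ (I ^ n • (⊤ : Submodule A M))) ≠ ⊤ := by
  obtain ⟨r, x, hx⟩ := Submodule.fg_iff_exists_fin_generating_family.1
    ((isNoetherianRing_iff_ideal_fg A).1 inferInstance I)
  induction n with
  | zero =>
    rw [pow_zero, Ideal.one_eq_top, Submodule.top_smul, Module.length_eq_zero]
    exact ENat.zero_ne_top
  | succ n ih =>
    -- `φ` has image `IM` and sends `(IⁿM)^r` into `Iⁿ⁺¹M`. Hence `M / Iⁿ⁺¹M` is an extension of a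
    -- quotient of `M / IM` by an image of `(M / IⁿM)^r`.
    let φ : (Fin r → M) →ₗ[A] M := ∑ j, x j • LinearMap.proj j
    have hφ : LinearMap.range φ = I • ⊤ := by
      apply le_antisymm
      · rintro _ ⟨y, rfl⟩
        simp only [φ, LinearMap.sum_apply, LinearMap.smul_apply, LinearMap.proj_apply]
        refine Submodule.sum_mem _ fun j _ => Submodule.smul_mem_smul ?_ trivial
        rw [← hx]
        exact Submodule.subset_span ⟨j, rfl⟩
      · rw [← hx]
        refine span_smul_le_of_forall fun j m _ => ⟨Pi.single j m, ?_⟩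
        simp only [φ, LinearMap.sum_apply, LinearMap.smul_apply, LinearMap.proj_apply]
        rw [Finset.sum_eq_single j (fun k _ hk => by rw [Pi.single_eq_of_ne hk, smul_zero])
          (by simp), Pi.single_eq_same]
    have hle : Submodule.pi Set.univ (fun _ : Fin r => I ^ n • (⊤ : Submodule A M)) ≤
        (I ^ (n + 1) • (⊤ : Submodule A M)).comap φ := by
      intro y hy
      simp only [φ, Submodule.mem_comap, LinearMap.sum_apply, LinearMap.smul_apply,
        LinearMap.proj_apply]
      refine Submodule.sum_mem _ fun j _ => ?_
      rw [pow_succ', Submodule.mul_smul]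
      refine Submodule.smul_mem_smul ?_ (hy j trivial)
      rw [← hx]
      exact Submodule.subset_span ⟨j, rfl⟩
    have hpi : Module.length A ((Fin r → M) ⧸
        Submodule.pi Set.univ (fun _ : Fin r => I ^ n • (⊤ : Submodule A M))) ≠ ⊤ := by
      rw [(Submodule.quotientPi _).length_eq, Module.length_pi_of_fintype]
      exact WithTop.sum_ne_top.2 fun _ _ => ih
    rw [Module.length_eq_add_of_exact
      ((LinearMap.range (Submodule.mapQ _ (I ^ (n + 1) • ⊤) φ hle)).subtype)
      (LinearMap.range (Submodule.mapQ _ (I ^ (n + 1) • ⊤) φ hle)).mkQ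
      (Submodule.subtype_injective _) (Submodule.mkQ_surjective _)
      (LinearMap.exact_subtype_mkQ _)]
    refine WithTop.add_ne_top.2 ⟨?_, ?_⟩
    · exact ne_top_of_le_ne_top hpi
        (Module.length_le_of_surjective _ (LinearMap.surjective_rangeRestrict _))
    · rw [Submodule.range_mapQ, (Submodule.quotientQuotientEquivQuotientSup _ _).length_eq]
      refine length_quotient_ne_top_of_le ?_ h
      rw [hφ]
      exact le_sup_right

/-- If `M / IM` has finite length and `IZ ≤ B ≤ Z ≤ M`, then `Z / B` has finite length. -/
lemma relLength_ne_top_of_smul_le [IsNoetherianRing A] [Module.Finite A M] (I : Ideal A)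
    (h : Module.length A (M ⧸ (I • (⊤ : Submodule A M))) ≠ ⊤) {B Z : Submodule A M}
    (hBZ : I • Z ≤ B) : relLength B Z ≠ ⊤ := by
  -- Artin-Rees gives `Iᵏ⁺¹M ∩ Z ⊆ IZ ⊆ B`, so `Z / B` is a quotient of a submodule of `M / Iᵏ⁺¹M`.
  obtain ⟨k, hk⟩ := Ideal.exists_pow_inf_eq_pow_smul I Z
  have hle : (I ^ (k + 1) • (⊤ : Submodule A M)).submoduleOf Z ≤ B.submoduleOf Z := by
    intro z hz
    have : (z : M) ∈ I ^ (k + 1) • (⊤ : Submodule A M) ⊓ Z := ⟨hz, z.2⟩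
    rw [hk _ (by omega), Nat.add_sub_cancel_left, pow_one] at this
    exact hBZ (Submodule.smul_mono le_rfl inf_le_right this)
  refine length_quotient_ne_top_of_le hle ?_
  refine ne_top_of_le_ne_top (length_quotient_pow_smul_ne_top I h (k + 1))
    (Module.length_le_of_injective
      (Submodule.mapQ _ (I ^ (k + 1) • (⊤ : Submodule A M)) Z.subtype le_rfl) ?_)
  rw [← LinearMap.ker_eq_bot]
  exact Submodule.ker_liftQ_eq_bot _ _ _ (by simp [LinearMap.ker_comp, Submodule.submoduleOf])

end FiniteLength

/-! ### Exterior multiplication, and homology as cycles modulo boundaries. -/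

section Wedge

variable {A : Type u} [CommRing A] {t : ℕ} {M : Type v} [AddCommGroup M] [Module A M]

/-- Exterior multiplication by the basis vector `e_j` on the Koszul complex. -/
def wedge (j : Fin t) {i : ℕ} (x : Idx t i → M) : Idx t (i + 1) → M := fun J =>
  if h : j ∈ J.1 then
    sgn (J.1.erase j) j • x ⟨J.1.erase j, by rw [Finset.card_erase_of_mem h, J.2]; rfl⟩
  else 0

/-- The extension by zero of a family indexed by the subsets with `i` elements. -/
def extendZero {i : ℕ} (x : Idx t i → M) (S : Finset (Fin t)) : M :=
  if h : S.card = i then x ⟨S, h⟩ else 0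

lemma extendZero_coe {i : ℕ} (x : Idx t i → M) (J : Idx t i) : extendZero x J.1 = x J :=
  dif_pos J.2

lemma wedge_apply (j : Fin t) {i : ℕ} (x : Idx t i → M) (J : Idx t (i + 1)) :
    wedge j x J =
      if j ∈ J.1 then sgn (J.1.erase j) j • extendZero x (J.1.erase j) else 0 := by
  unfold wedge
  split_ifs with h
  · rw [← extendZero_coe x]
  · rfl

lemma koszulD_apply_eq_sum_compl (a : Fin t → A) {i : ℕ} (x : Idx t (i + 1) → M) (J : Idx t i) :
    koszulD a M i x J =
      ∑ k ∈ J.1ᶜ, (sgn J.1 k • a k) • extendZero x (Insert.insert k J.1) := by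
  rw [koszulD_apply, Finset.sum_subtype (p := fun k => k ∉ J.1) _ (by simp)]
  refine Finset.sum_congr rfl fun k _ => ?_
  rw [← extendZero_coe x]
  rfl

lemma sgn_mul_self (J : Finset (Fin t)) (k : Fin t) : sgn J k * sgn J k = 1 := by
  rw [sgn, ← mul_pow]
  simp

lemma sgn_insert_mul_sgn_insert {S : Finset (Fin t)} {j k : Fin t} (hj : j ∉ S) (hk : k ∉ S)
    (hjk : j ≠ k) :
    sgn (Insert.insert j S) k * sgn (Insert.insert k S) j = -(sgn S j * sgn S k) := by
  have h := sgn_mul_sgn_insert S hj hk hjk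
  have hj1 := sgn_mul_self S j
  have hk1 := sgn_mul_self (Insert.insert k S) j
  linear_combination (sgn S j * sgn (Insert.insert k S) j) * h -
    (sgn (Insert.insert j S) k * sgn (Insert.insert k S) j) * hj1 - (sgn S j * sgn S k) * hk1

/-- This is the homotopy formula `D(e_j ∧ x) = a_j x - e_j ∧ Dx`. The last term is written out so
that `i = 0`, where no `Dx` is available, needs no separate case. -/
lemma koszulD_wedge (a : Fin t → A) (j : Fin t) {i : ℕ} (x : Idx t i → M) (J : Idx t i) :
    koszulD a M i (wedge j x) J = a j • x J -
      if j ∈ J.1 then sgn (J.1.erase j) j • ∑ k ∈ (J.1.erase j)ᶜ,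
        (sgn (J.1.erase j) k • a k) • extendZero x (Insert.insert k (J.1.erase j)) else 0 := by
  have hw (k : Fin t) (hk : k ∉ J.1) : extendZero (wedge j x) (Insert.insert k J.1) =
      if j ∈ Insert.insert k J.1 then sgn ((Insert.insert k J.1).erase j) j •
        extendZero x ((Insert.insert k J.1).erase j) else 0 := by
    exact (extendZero_coe _ (J.insert ⟨k, hk⟩)).trans (wedge_apply j x (J.insert ⟨k, hk⟩))
  rw [koszulD_apply_eq_sum_compl]
  by_cases hj : j ∈ J.1
  -- In the sum over `Sᶜ` the index `k = j` reproduces `a_j x_J`; the other indices match by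
  -- anticommutativity of the signs.
  · obtain ⟨S, hS⟩ : ∃ S, S = J.1.erase j := ⟨_, rfl⟩
    have hjS : j ∉ S := by simp [hS]
    have hJ : J.1 = Insert.insert j S := by rw [hS, Finset.insert_erase hj]
    have hc : Sᶜ = Insert.insert j J.1ᶜ := by
      ext k
      by_cases hk : k = j <;> simp [hJ, hk, hjS]
    rw [if_pos hj, ← hS, hc, Finset.sum_insert (by simp [hj]), ← hJ, extendZero_coe, smul_add,
      smul_assoc, smul_smul, sgn_mul_self, one_smul, sub_add_cancel_left, Finset.smul_sum,
      ← Finset.sum_neg_distrib]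
    refine Finset.sum_congr rfl fun k hk => ?_
    rw [Finset.mem_compl] at hk
    have hkS : k ∉ S := fun h => hk (by rw [hJ]; exact Finset.mem_insert_of_mem h)
    have hkj : j ≠ k := by
      rintro rfl
      exact hk hj
    have he : (Insert.insert k J.1).erase j = Insert.insert k S := by
      rw [hJ, Finset.insert_comm, Finset.erase_insert]
      simp [hjS, hkj]
    rw [hw k hk, if_pos (Finset.mem_insert_of_mem hj), he, smul_comm, smul_assoc, smul_smul,
      smul_assoc, smul_smul, ← neg_smul, hJ, mul_comm, sgn_insert_mul_sgn_insert hjS hkS hkj]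
  · rw [if_neg hj, sub_zero, Finset.sum_eq_single j]
    · rw [hw j hj, if_pos (Finset.mem_insert_self _ _), Finset.erase_insert hj, extendZero_coe,
        smul_comm, smul_assoc, smul_smul, sgn_mul_self, one_smul]
    · intro k hk hkj
      rw [hw k (Finset.mem_compl.1 hk), if_neg, smul_zero]
      simp [hj, hkj.symm]
    · intro h
      exact absurd (Finset.mem_compl.2 hj) h

/-- On cycles, `D (e_j ∧ x) = a_j x`. -/
lemma koszulD_wedge_of_mem_subCycles (a : Fin t → A) (j : Fin t) {i : ℕ}
    {G : ∀ i, Submodule A (Idx t i → M)} {x : Idx t i → M}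
    (hx : x ∈ subCycles (koszulD a M) G i) : koszulD a M i (wedge j x) = a j • x := by
  funext J
  rw [koszulD_wedge, Pi.smul_apply, sub_eq_self, ite_eq_right_iff]
  intro hj
  cases i with
  | zero =>
    have := J.2
    rw [Finset.card_eq_zero] at this
    simp [this] at hj
  | succ i =>
    have h0 : koszulD a M i x = 0 := hx.2
    have hS := koszulD_apply_eq_sum_compl a x
      ⟨J.1.erase j, by rw [Finset.card_erase_of_mem hj, J.2]; rfl⟩
    rw [h0] at hS
    rw [← hS]
    simp

/-- Adjoining `j` lowers the exponent by `c j`, which the shift of `n` compensates. -/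
lemma wedge_mem_genKoszulX {q : Ideal A} {c : Fin t → ℕ} (j : Fin t) {n i : ℕ}
    {x : Idx t i → M} (hx : x ∈ genKoszulX q c M n i) :
    wedge j x ∈ genKoszulX q c M (n + c j) (i + 1) := by
  intro J _
  unfold wedge
  split_ifs with h
  · refine zsmul_mem ?_ _
    have h1 := hx ⟨J.1.erase j, by rw [Finset.card_erase_of_mem h, J.2]; rfl⟩ trivial
    have h2 : ∑ k ∈ J.1, c k = c j + ∑ k ∈ J.1.erase j, c k :=
      (Finset.add_sum_erase _ _ h).symm
    have h3 : n + c j - ∑ k ∈ J.1, c k = n - ∑ k ∈ J.1.erase j, c k := by omega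
    change _ ∈ q ^ (n + c j - ∑ k ∈ J.1, c k) • (⊤ : Submodule A M)
    rw [h3]
    exact h1
  · exact zero_mem _

lemma genKoszulX_antitone (q : Ideal A) (c : Fin t → ℕ) (i : ℕ) {m n : ℕ} (h : m ≤ n) :
    genKoszulX q c M n i ≤ genKoszulX q c M m i :=
  Submodule.pi_mono fun _ _ =>
    Submodule.smul_mono_left (Ideal.pow_le_pow_right (Nat.sub_le_sub_right h _))

lemma genKoszulX_zero (q : Ideal A) (c : Fin t → ℕ) (i : ℕ) : genKoszulX q c M 0 i = ⊤ := by
  rw [eq_top_iff]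
  intro x _ J _
  simp

lemma relLength_genKoszulX (q : Ideal A) (c : Fin t → ℕ) (n i : ℕ) :
    relLength (genKoszulX q c M n i) (genKoszulX q c M 0 i) =
      ∑ J : Idx t i, Module.length A (M ⧸ (q ^ (n - ∑ j ∈ J.1, c j) • (⊤ : Submodule A M))) := by
  rw [genKoszulX_zero, relLength_top, genKoszulX, (Submodule.quotientPi _).length_eq,
    Module.length_pi_of_fintype]

/-- There are no index sets of this size, so the ambient module is zero. This supplies the vanishing
above degree `t` required by `sum_homologyLength_eq`. -/
lemma genKoszulX_of_lt (q : Ideal A) (c : Fin t → ℕ) (n : ℕ) {i : ℕ} (hi : t < i) :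
    genKoszulX q c M n i = ⊤ := by
  rw [eq_top_iff]
  intro x _ J _
  have h1 := Finset.card_le_univ J.1
  rw [J.2, Fintype.card_fin] at h1
  omega

lemma nonempty_shortComplex_homology_equiv (S : CategoryTheory.ShortComplex (ModuleCat.{v} A))
    {F : Type*} [AddCommGroup F] [Module A F] {G Z B : Submodule A F} (e : S.X₂ ≃ₗ[A] G)
    (hZG : Z ≤ G) (hZ : ∀ x, (e x : F) ∈ Z ↔ S.g.hom x = 0)
    (hB : ∀ x, (e x : F) ∈ B ↔ ∃ y, S.f.hom y = x) :
    Nonempty (S.homology ≃ₗ[A] Z ⧸ B.submoduleOf Z) := by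
  let φ : LinearMap.ker S.g.hom →ₗ[A] Z :=
    (G.subtype ∘ₗ e.toLinearMap ∘ₗ (LinearMap.ker S.g.hom).subtype).codRestrict Z
      fun x => (hZ x.1).2 x.2
  have hφ : Function.Bijective φ := by
    constructor
    · intro x y hxy
      exact Subtype.ext (e.injective (Subtype.ext (congrArg (fun z : Z => (z : F)) hxy)))
    · intro z
      obtain ⟨x, hx⟩ := e.surjective ⟨z.1, hZG z.2⟩
      have hxz : (e x : F) = z := congrArg Subtype.val hx
      exact ⟨⟨x, (hZ x).1 (hxz ▸ z.2)⟩, Subtype.ext hxz⟩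
  refine ⟨S.moduleCatHomologyIso.toLinearEquiv.trans
    (Submodule.Quotient.equiv _ _ (LinearEquiv.ofBijective φ hφ) ?_)⟩
  ext z
  obtain ⟨x, rfl⟩ := hφ.2 z
  constructor
  · rintro ⟨_, ⟨y, rfl⟩, hy⟩
    rw [← hy]
    exact (hB _).2 ⟨y, rfl⟩
  · intro h
    obtain ⟨y, hy⟩ := (hB x.1).1 h
    exact ⟨x, ⟨y, Subtype.ext hy⟩, rfl⟩

/-- The homology of the generalized Koszul complex as cycles modulo boundaries. -/
lemma nonempty_homology_equiv (a : Fin t → A) (q : Ideal A) (c : Fin t → ℕ)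
    (ha : ∀ i, a i ∈ q ^ c i) (n i : ℕ) :
    Nonempty ((genKoszulComplex a q c ha M n).homology i ≃ₗ[A]
      subCycles (koszulD a M) (genKoszulX q c M n) i ⧸
        (subBoundaries (koszulD a M) (genKoszulX q c M n) i).submoduleOf
          (subCycles (koszulD a M) (genKoszulX q c M n) i)) := by
  have hd (i : ℕ) : (genKoszulComplex a q c ha M n).d (i + 1) i = ModuleCat.ofHom
      ((koszulD a M i).restrict fun _ hx => koszulD_mem ha n i hx) :=
    ChainComplex.of_d (fun i => ModuleCat.of A (genKoszulX q c M n i))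
      (fun i => ModuleCat.ofHom
        ((koszulD a M i).restrict fun _ hx => koszulD_mem ha n i hx)) i
  have hB (i : ℕ) (x : genKoszulX q c M n i) :
      (x : Idx t i → M) ∈ subBoundaries (koszulD a M) (genKoszulX q c M n) i ↔
        ∃ y, ((genKoszulComplex a q c ha M n).d (i + 1) i).hom y = x := by
    rw [hd]
    constructor
    · rintro ⟨y, hy, hyx⟩
      exact ⟨⟨y, hy⟩, Subtype.ext hyx⟩
    · rintro ⟨y, hy⟩
      exact ⟨y.1, y.2, congrArg Subtype.val hy⟩
  cases i with
  | zero =>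
    -- In degree `0` the outgoing map is `d 0 0`, which is zero by the shape of the complex.
    obtain ⟨e⟩ := nonempty_shortComplex_homology_equiv
      ((genKoszulComplex a q c ha M n).sc' 1 0 0) (LinearEquiv.refl A (genKoszulX q c M n 0))
      (subCycles_le (D := koszulD a M) (genKoszulX q c M n) 0)
      (fun x => ⟨fun _ => by
        change ((genKoszulComplex a q c ha M n).d 0 0).hom x = 0
        rw [(genKoszulComplex a q c ha M n).shape 0 0 (by simp)]
        rfl, fun _ => x.2⟩)
      (hB 0)
    exact ⟨(CategoryTheory.ShortComplex.homologyMapIso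
      ((genKoszulComplex a q c ha M n).isoSc' 1 0 0 (by simp) (by simp))).toLinearEquiv.trans e⟩
  | succ i =>
    obtain ⟨e⟩ := nonempty_shortComplex_homology_equiv
      ((genKoszulComplex a q c ha M n).sc' (i + 2) (i + 1) i)
      (LinearEquiv.refl A (genKoszulX q c M n (i + 1)))
      (subCycles_le (D := koszulD a M) (genKoszulX q c M n) (i + 1))
      (fun x => by
        change _ ↔ ((genKoszulComplex a q c ha M n).d (i + 1) i).hom x = 0
        rw [hd]
        exact ⟨fun h => Subtype.ext h.2, fun h => ⟨x.2, congrArg Subtype.val h⟩⟩)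
      (hB (i + 1))
    exact ⟨(CategoryTheory.ShortComplex.homologyMapIso
      ((genKoszulComplex a q c ha M n).isoSc' (i + 2) (i + 1) i (by simp)
        (by simp))).toLinearEquiv.trans e⟩

end Wedge

/-! ### Finite differences and growth of polynomials. -/

section Differences

open Polynomial

/-- Iterated differences of a polynomial with varying steps. -/
lemma sum_powerset_eval_sub_sum {ι : Type*} [DecidableEq ι] (c : ι → ℚ) (S : Finset ι)
    (P : ℚ[X]) (hP : P.natDegree ≤ S.card) (x : ℚ) :
    ∑ J ∈ S.powerset, (-1 : ℚ) ^ J.card * P.eval (x - ∑ j ∈ J, c j) =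
      (∏ j ∈ S, c j) * S.card.factorial * P.coeff S.card := by
  induction S using Finset.induction_on generalizing P with
  | empty =>
    rw [Finset.card_empty, Nat.le_zero] at hP
    rw [eq_C_of_natDegree_eq_zero hP]
    simp
  | insert s S hs ih =>
    rw [Finset.card_insert_of_notMem hs] at hP ⊢
    -- `Q(X) = P(X) - P(X - c_s)` has degree at most `S.card`; pairing `J` with `J ∪ {s}` reduces
    -- the sum to that of `Q` over `S`.
    set Q : ℚ[X] := P - taylor (-c s) P with hQ
    have hcoeff (m : ℕ) (hm : S.card ≤ m) : Q.coeff m = (m + 1) * P.coeff (m + 1) * c s := by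
      have h2 : (hasseDeriv m P).natDegree ≤ 1 :=
        (natDegree_hasseDeriv_le P m).trans (by omega)
      rw [hQ, coeff_sub, taylor_coeff, eq_X_add_C_of_natDegree_le_one h2]
      simp only [hasseDeriv_coeff, eval_add, eval_mul, eval_C, eval_X]
      simp [add_comm 1 m]
    have hdeg : Q.natDegree ≤ S.card := by
      rw [natDegree_le_iff_coeff_eq_zero]
      intro m hm
      rw [hcoeff m hm.le, coeff_eq_zero_of_natDegree_lt (by omega)]
      simp
    rw [Finset.sum_powerset_insert hs, ← Finset.sum_add_distrib, Finset.prod_insert hs,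
      Nat.factorial_succ]
    have key := ih Q hdeg
    rw [hcoeff _ le_rfl] at key
    push_cast
    rw [show c s * (∏ j ∈ S, c j) * (((S.card : ℚ) + 1) * S.card.factorial) *
      P.coeff (S.card + 1) = (∏ j ∈ S, c j) * S.card.factorial *
        (((S.card : ℚ) + 1) * P.coeff (S.card + 1) * c s) by ring, ← key]
    refine Finset.sum_congr rfl fun J hJ => ?_
    have hsJ : s ∉ J := fun h => hs (Finset.mem_powerset.1 hJ h)
    rw [Finset.card_insert_of_notMem hsJ, Finset.sum_insert hsJ, hQ, eval_sub, taylor_eval,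
      pow_succ, show x - ∑ j ∈ J, c j + -c s = x - (c s + ∑ j ∈ J, c j) by ring]
    ring

open fwdDiff in
/-- A function on `ℕ` whose `r`-th difference is eventually constant is eventually polynomial. -/
lemma exists_polynomial_of_fwdDiff_iter_eventually_const (L : ℕ → ℚ) (r : ℕ) (χ : ℚ)
    (h : ∀ᶠ n in Filter.atTop, (fwdDiff 1)^[r] L n = χ) :
    ∃ P : ℚ[X], P.natDegree ≤ r ∧ ∀ᶠ n : ℕ in Filter.atTop, L n = P.eval (n : ℚ) := by
  obtain ⟨N, hN⟩ := Filter.eventually_atTop.1 h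
  have hzero (k : ℕ) : ∀ n ≥ N, (fwdDiff 1)^[r + 1 + k] L n = 0 := by
    induction k with
    | zero =>
      intro n hn
      rw [add_zero, Function.iterate_succ_apply', fwdDiff, hN n hn, hN (n + 1) (by omega), sub_self]
    | succ k ih =>
      intro n hn
      rw [← add_assoc, Function.iterate_succ_apply', fwdDiff, ih n hn, ih (n + 1) (by omega),
        sub_self]
  -- Newton's interpolation formula based at `N`, cut off at `r` since higher differences vanish
  -- from `N` on.
  let R : ℚ[X] := ∑ k ∈ Finset.range (r + 1),
    C ((fwdDiff 1)^[k] L N / k.factorial) * descPochhammer ℚ k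
  have hR (m : ℕ) : L (N + m) = R.eval (m : ℚ) := by
    have h1 := shift_eq_sum_fwdDiff_iter 1 L m N
    rw [smul_eq_mul, mul_one] at h1
    have h2 : ∑ k ∈ Finset.range (m + 1), m.choose k • (fwdDiff 1)^[k] L N =
        ∑ k ∈ Finset.range (r + 1), m.choose k • (fwdDiff 1)^[k] L N := by
      rcases le_total m r with hmr | hmr
      · refine Finset.sum_subset (Finset.range_mono (by omega)) fun k _ hk => ?_
        rw [Nat.choose_eq_zero_of_lt (by simpa using hk), zero_smul]
      · refine (Finset.sum_subset (Finset.range_mono (by omega)) fun k _ hk => ?_).symm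
        obtain ⟨l, rfl⟩ := Nat.exists_eq_add_of_le (show r + 1 ≤ k by simpa using hk)
        rw [hzero l N le_rfl, smul_zero]
    rw [h1, h2, eval_finsetSum]
    refine Finset.sum_congr rfl fun k _ => ?_
    rw [nsmul_eq_mul, Nat.cast_choose_eq_descPochhammer_div, eval_mul, eval_C]
    ring
  have hRdeg : R.natDegree ≤ r := by
    refine natDegree_sum_le_of_forall_le _ _ fun k hk => ?_
    refine (natDegree_C_mul_le _ _).trans ?_
    rw [descPochhammer_natDegree]
    simpa [Nat.lt_succ_iff] using hk
  refine ⟨taylor (-(N : ℚ)) R, by rwa [natDegree_taylor], ?_⟩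
  filter_upwards [Filter.eventually_ge_atTop N] with n hn
  obtain ⟨m, rfl⟩ := Nat.exists_eq_add_of_le hn
  rw [hR, taylor_eval]
  congr 1
  push_cast
  ring

lemma tendsto_eval_natCast_atBot {P : ℚ[X]} (hdeg : 0 < P.degree) (hP : P.leadingCoeff ≤ 0) :
    Filter.Tendsto (fun n : ℕ => P.eval (n : ℚ)) Filter.atTop Filter.atBot :=
  (P.tendsto_atBot_of_leadingCoeff_nonpos hdeg hP).comp tendsto_natCast_atTop_atTop

/-- If the degree of `P` exceeded `d`, then `P` or `Q - P` would tend to `-∞`, according to the sign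
of the leading coefficient of `P`. -/
lemma natDegree_le_of_eventually_le {P Q : ℚ[X]} {d : ℕ} (hQ : Q.natDegree ≤ d)
    (h0 : ∀ᶠ n : ℕ in Filter.atTop, 0 ≤ P.eval (n : ℚ))
    (h : ∀ᶠ n : ℕ in Filter.atTop, P.eval (n : ℚ) ≤ Q.eval (n : ℚ)) : P.natDegree ≤ d := by
  by_contra! hd
  have hP : 0 < P.degree := natDegree_pos_iff_degree_pos.1 (by omega)
  have hlt : Q.degree < P.degree := degree_lt_degree (by omega)
  rcases le_total P.leadingCoeff 0 with hl | hl
  · obtain ⟨n, h1, h2⟩ :=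
      (((tendsto_eval_natCast_atBot hP hl).eventually_lt_atBot 0).and h0).exists
    exact absurd h1 h2.not_gt
  · have hdeg : (Q - P).degree = P.degree := degree_sub_eq_right_of_degree_lt hlt
    have hlc : (Q - P).leadingCoeff ≤ 0 := by
      rw [leadingCoeff_sub_of_degree_lt' hlt]
      linarith
    obtain ⟨n, h1, h2⟩ :=
      (((tendsto_eval_natCast_atBot (hdeg ▸ hP) hlc).eventually_lt_atBot 0).and h).exists
    rw [eval_sub] at h1
    linarith

end Differences

/-! ### Euler characteristics and Hilbert-Samuel polynomials. -/

section EulerCharacteristic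

variable {A : Type u} [CommRing A] {t : ℕ} {M : Type v} [AddCommGroup M] [Module A M]

lemma span_smul_subCycles_le (a : Fin t → A) (q : Ideal A) (c : Fin t → ℕ) (n i : ℕ) :
    Ideal.span (Set.range a) • subCycles (koszulD a M) (genKoszulX q c M n) i ≤
      subBoundaries (koszulD a M) (genKoszulX q c M n) i :=
  span_smul_le_of_forall fun j x hx =>
    ⟨wedge j x, genKoszulX_antitone q c _ (Nat.le_add_right n (c j))
      (wedge_mem_genKoszulX j (subCycles_le _ _ hx)), koszulD_wedge_of_mem_subCycles a j hx⟩

/-- With `c = 1` each term is a step of the `q`-adic filtration, which is what Artin-Rees needs. -/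
lemma genKoszulX_one (q : Ideal A) (n i : ℕ) :
    genKoszulX q (1 : Fin t → ℕ) M n i = q ^ (n - i) • (⊤ : Submodule A (Idx t i → M)) := by
  have hJ (J : Idx t i) : ∑ j ∈ J.1, (1 : Fin t → ℕ) j = i := by simp [J.2]
  apply le_antisymm
  · intro x hx
    rw [← Finset.univ_sum_single x]
    refine Submodule.sum_mem _ fun J _ => ?_
    have h1 : x J ∈ q ^ (n - ∑ j ∈ J.1, (1 : Fin t → ℕ) j) • (⊤ : Submodule A M) := hx J trivial
    rw [hJ] at h1
    have h2 := Submodule.mem_map_of_mem (f := LinearMap.single A (fun _ : Idx t i => M) J) h1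
    rw [Submodule.map_smul''] at h2
    exact Submodule.smul_mono le_rfl le_top h2
  · rw [Submodule.smul_le]
    intro r hr x _ J _
    change r • x J ∈ q ^ (n - ∑ j ∈ J.1, (1 : Fin t → ℕ) j) • (⊤ : Submodule A M)
    rw [hJ]
    exact Submodule.smul_mem_smul hr trivial

lemma eulerChar_genKoszulComplex (a : Fin t → A) (q : Ideal A) (c : Fin t → ℕ)
    (ha : ∀ i, a i ∈ q ^ c i) (N n : ℕ) :
    eulerChar N (genKoszulComplex a q c ha M n) = ∑ i ∈ Finset.range (N + 1), (-1 : ℤ) ^ i *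
      ((homologyLength (koszulD a M) (genKoszulX q c M n) i).toNat : ℤ) := by
  refine Finset.sum_congr rfl fun i _ => ?_
  obtain ⟨e⟩ := nonempty_homology_equiv (M := M) a q c ha n i
  rw [e.length_eq]
  rfl

lemma mem_span_range_pow_one (a : Fin t → A) (i : Fin t) :
    a i ∈ Ideal.span (Set.range a) ^ (1 : Fin t → ℕ) i := by
  rw [Pi.one_apply, pow_one]
  exact Submodule.subset_span ⟨i, rfl⟩

lemma IsHilbertSamuelPoly.eventually_eq {I : Ideal A} {P : Polynomial ℚ}
    (hP : IsHilbertSamuelPoly I M P) : ∀ᶠ n : ℕ in Filter.atTop,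
      ((Module.length A (M ⧸ (I ^ n • (⊤ : Submodule A M)))).toNat : ℚ) = P.eval (n : ℚ) := by
  filter_upwards [hP] with n ⟨l, hl, hlP⟩
  rw [hl, ← hlP]
  rfl

variable [IsNoetherianRing A] [Module.Finite A M]

lemma homologyLength_genKoszulX_ne_top (a : Fin t → A) (q : Ideal A) (c : Fin t → ℕ)
    (h : Module.length A (M ⧸ (Ideal.span (Set.range a) • (⊤ : Submodule A M))) ≠ ⊤)
    (n i : ℕ) : homologyLength (koszulD a M) (genKoszulX q c M n) i ≠ ⊤ := by
  refine relLength_ne_top_of_smul_le (Ideal.span (Set.range a)) ?_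
    (span_smul_subCycles_le a q c n i)
  -- Level `i + 1` is `I · K_i` for `I = (a)`, so `relLength_genKoszulX` computes the length of `K_i
  -- / I K_i`.
  have hle : genKoszulX (Ideal.span (Set.range a)) (1 : Fin t → ℕ) M (i + 1) i =
      Ideal.span (Set.range a) • (⊤ : Submodule A (Idx t i → M)) := by
    rw [genKoszulX_one, Nat.add_sub_cancel_left, pow_one]
  rw [← hle, ← relLength_top, ← genKoszulX_zero (Ideal.span (Set.range a)) (1 : Fin t → ℕ) i,
    relLength_genKoszulX]
  exact WithTop.sum_ne_top.2 fun J _ => length_quotient_pow_smul_ne_top _ h _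

/-- The homology of `K_•(a, (a), M; n)` vanishes for large `n`. -/
lemma eventually_homologyLength_eq_zero (a : Fin t → A) (i : ℕ) :
    ∀ᶠ n in Filter.atTop, homologyLength (koszulD a M)
      (genKoszulX (Ideal.span (Set.range a)) (1 : Fin t → ℕ) M n) i = 0 := by
  set I := Ideal.span (Set.range a)
  set Z := subCycles (F := fun i => Idx t i → M) (koszulD a M) (fun _ => ⊤) i
  obtain ⟨k, hk⟩ := Ideal.exists_pow_inf_eq_pow_smul I Z
  have hZ (n : ℕ) : subCycles (koszulD a M) (genKoszulX I (1 : Fin t → ℕ) M n) i =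
      I ^ (n - i) • (⊤ : Submodule A (Idx t i → M)) ⊓ Z := by
    rw [← genKoszulX_one]
    cases i with
    | zero => exact (inf_top_eq _).symm
    | succ i =>
      exact congrArg (genKoszulX I (1 : Fin t → ℕ) M n (i + 1) ⊓ ·)
        (top_inf_eq (LinearMap.ker (koszulD a M i))).symm
  -- Both `n - i` and `n - 1 - i` are then at least the Artin-Rees constant `k`, so cycles at level
  -- `n` are `I` times cycles at level `n - 1`; `wedge j` raises the level back to `n`.
  filter_upwards [Filter.eventually_ge_atTop (k + i + 1)] with n hn
  refine relLength_eq_zero_of_le ?_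
  have hle : subCycles (koszulD a M) (genKoszulX I (1 : Fin t → ℕ) M n) i =
      I • subCycles (koszulD a M) (genKoszulX I (1 : Fin t → ℕ) M (n - 1)) i := by
    rw [hZ, hZ, hk (n - i) (by omega), hk (n - 1 - i) (by omega), ← Submodule.mul_smul, ← pow_succ',
      show n - 1 - i - k + 1 = n - i - k by omega]
  rw [hle]
  refine span_smul_le_of_forall fun j x hx => ⟨wedge j x, ?_, koszulD_wedge_of_mem_subCycles a j hx⟩
  have h1 := wedge_mem_genKoszulX j (subCycles_le _ _ hx)
  rwa [Pi.one_apply, Nat.sub_add_cancel (by omega)] at h1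

lemma isFiniteLength_homology_genKoszulComplex (a : Fin t → A) (q : Ideal A) (c : Fin t → ℕ)
    (ha : ∀ i, a i ∈ q ^ c i)
    (h : Module.length A (M ⧸ (Ideal.span (Set.range a) • (⊤ : Submodule A M))) ≠ ⊤)
    (n i : ℕ) : IsFiniteLength A ((genKoszulComplex a q c ha M n).homology i) := by
  obtain ⟨e⟩ := nonempty_homology_equiv (M := M) a q c ha n i
  rw [← Module.length_ne_top_iff, e.length_eq]
  exact homologyLength_genKoszulX_ne_top a q c h n i

/-- The Euler characteristic of the Koszul complex, compared with the one of `K_•(a, q, M; n)`. -/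
lemma eulerChar_koszul_eq (a : Fin t → A) (q : Ideal A) (hq : Ideal.span (Set.range a) ≤ q)
    (c : Fin t → ℕ) (ha : ∀ i, a i ∈ q ^ c i)
    (h : Module.length A (M ⧸ (Ideal.span (Set.range a) • (⊤ : Submodule A M))) ≠ ⊤) (n : ℕ) :
    eulerChar t (genKoszulComplex a q c ha M 0) = eulerChar t (genKoszulComplex a q c ha M n) +
      ∑ J ∈ (Finset.univ : Finset (Fin t)).powerset, (-1 : ℤ) ^ J.card *
        ((Module.length A
          (M ⧸ (q ^ (n - ∑ j ∈ J, c j) • (⊤ : Submodule A M)))).toNat : ℤ) := by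
  have hlen (k : ℕ) : Module.length A (M ⧸ (q ^ k • (⊤ : Submodule A M))) ≠ ⊤ :=
    length_quotient_pow_smul_ne_top q
      (length_quotient_ne_top_of_le (Submodule.smul_mono_left hq) h) k
  have key := sum_homologyLength_eq (F := fun i => Idx t i → M) (D := koszulD a M)
    (G := genKoszulX q c M n) (H := genKoszulX q c M 0) (koszulD_comp_koszulD a)
    (fun i x hx => koszulD_mem ha n i hx) (fun i x hx => koszulD_mem ha 0 i hx)
    (fun i => genKoszulX_antitone q c i n.zero_le)
    (fun i => by
      rw [relLength_genKoszulX]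
      exact WithTop.sum_ne_top.2 fun J _ => hlen _)
    (homologyLength_genKoszulX_ne_top a q c h n) t
    (by
      rw [genKoszulX_of_lt q c n t.lt_succ_self]
      exact le_top)
  rw [eulerChar_genKoszulComplex, eulerChar_genKoszulComplex, key]
  congr 1
  -- Group the subsets by cardinality, which is the homological degree.
  rw [Finset.sum_powerset, Finset.card_univ, Fintype.card_fin]
  refine Finset.sum_congr rfl fun i _ => ?_
  rw [relLength_genKoszulX, Finset.sum_subtype (p := fun J : Finset (Fin t) => J.card = i) _
    (by simp), ENat.toNat_sum fun J _ => hlen _, Nat.cast_sum, Finset.mul_sum]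
  exact Finset.sum_congr rfl fun J _ => by rw [J.2]

lemma eventually_eulerChar_genKoszulComplex_span_eq_zero (a : Fin t → A)
    (ha : ∀ i, a i ∈ Ideal.span (Set.range a) ^ (1 : Fin t → ℕ) i) :
    ∀ᶠ n in Filter.atTop,
      eulerChar t (genKoszulComplex a (Ideal.span (Set.range a)) 1 ha M n) = 0 := by
  have := (Filter.eventually_all_finset (Finset.range (t + 1))).2
    fun i _ => eventually_homologyLength_eq_zero (M := M) a i
  filter_upwards [this] with n hn
  rw [eulerChar_genKoszulComplex]
  refine Finset.sum_eq_zero fun i hi => ?_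
  rw [hn i hi]
  simp

/-- The Hilbert-Samuel polynomial of an ideal with `t` generators exists and has degree `≤ t`. -/
theorem exists_isHilbertSamuelPoly_span (a : Fin t → A)
    (h : Module.length A (M ⧸ (Ideal.span (Set.range a) • (⊤ : Submodule A M))) ≠ ⊤) :
    ∃ P : Polynomial ℚ, P.natDegree ≤ t ∧ IsHilbertSamuelPoly (Ideal.span (Set.range a)) M P := by
  set I := Ideal.span (Set.range a) with hI
  set L : ℕ → ℚ := fun n => ((Module.length A (M ⧸ (I ^ n • (⊤ : Submodule A M)))).toNat : ℚ)
  -- At level `n + t` with `c = 1`, no subtraction is truncated and the alternating sum is the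
  -- `t`-th forward difference of `L` at `n`.
  obtain ⟨P, hPt, hP⟩ := exists_polynomial_of_fwdDiff_iter_eventually_const L t
    (eulerChar t (genKoszulComplex a I 1 (mem_span_range_pow_one a) M 0)) (by
      filter_upwards [(Filter.tendsto_add_atTop_nat t).eventually
        (eventually_eulerChar_genKoszulComplex_span_eq_zero (M := M) a
          (mem_span_range_pow_one a))] with n hn
      rw [eulerChar_koszul_eq a I le_rfl 1 (mem_span_range_pow_one a) h (n + t), hn, zero_add]
      have hJ (J : Finset (Fin t)) : ∑ j ∈ J, (1 : Fin t → ℕ) j = J.card := by simp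
      have hL : ∑ J ∈ (Finset.univ : Finset (Fin t)).powerset, (-1 : ℚ) ^ J.card *
          L (n + t - ∑ j ∈ J, (1 : Fin t → ℕ) j) =
          ∑ J ∈ (Finset.univ : Finset (Fin t)).powerset, (-1 : ℚ) ^ J.card * L (n + t - J.card) :=
        Finset.sum_congr rfl fun J _ => by rw [hJ]
      push_cast
      refine Eq.trans ?_ hL.symm
      rw [Finset.sum_powerset_apply_card
        (fun m => (-1 : ℚ) ^ m * L (n + t - m)), Finset.card_univ, Fintype.card_fin,
        fwdDiff_iter_eq_sum_shift, ← Finset.sum_flip]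
      refine Finset.sum_congr rfl fun m hm => ?_
      have hmt : m ≤ t := by simpa [Nat.lt_succ_iff] using hm
      rw [Nat.choose_symm hmt, show t - (t - m) = m by omega,
        show n + (t - m) • 1 = n + t - m by simp; omega, zsmul_eq_mul, nsmul_eq_mul]
      push_cast
      ring)
  refine ⟨P, hPt, ?_⟩
  filter_upwards [hP] with n hn
  exact ⟨_, (ENat.natCast_toNat (length_quotient_pow_smul_ne_top I h n)).symm, hn⟩

/-- Existence follows from any finite generating family of `I`. Its size may exceed `dim M`, so the
sharper degree bound for `q` comes from `natDegree_le_of_isHilbertSamuelPoly`. -/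
lemma isHilbertSamuelPoly_hilbertSamuelPoly (I : Ideal A)
    (h : Module.length A (M ⧸ (I • (⊤ : Submodule A M))) ≠ ⊤) :
    IsHilbertSamuelPoly I M (hilbertSamuelPoly I M) := by
  obtain ⟨r, x, rfl⟩ := Submodule.fg_iff_exists_fin_generating_family.1
    ((isNoetherianRing_iff_ideal_fg A).1 inferInstance I)
  obtain ⟨P, -, hP⟩ := exists_isHilbertSamuelPoly_span x h
  have hex : ∃ P, IsHilbertSamuelPoly (Ideal.span (Set.range x)) M P := ⟨P, hP⟩
  change IsHilbertSamuelPoly (Ideal.span (Set.range x)) M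
    (hilbertSamuelPoly (Ideal.span (Set.range x)) M)
  rw [hilbertSamuelPoly, dif_pos hex]
  exact hex.choose_spec

/-- `M / qⁿM` is a quotient of `M / (a)ⁿM`, whose length has polynomial growth of degree at most
`t`. -/
lemma natDegree_le_of_isHilbertSamuelPoly (a : Fin t → A)
    (h : Module.length A (M ⧸ (Ideal.span (Set.range a) • (⊤ : Submodule A M))) ≠ ⊤)
    {q : Ideal A} (hq : Ideal.span (Set.range a) ≤ q) {P : Polynomial ℚ}
    (hP : IsHilbertSamuelPoly q M P) : P.natDegree ≤ t := by
  obtain ⟨Q, hQt, hQ⟩ := exists_isHilbertSamuelPoly_span a h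
  refine natDegree_le_of_eventually_le hQt ?_ ?_
  · filter_upwards [hP.eventually_eq] with n hn
    rw [← hn]
    exact Nat.cast_nonneg _
  · filter_upwards [hP.eventually_eq, hQ.eventually_eq] with n hn hn'
    rw [← hn, ← hn', Nat.cast_le]
    exact ENat.toNat_le_toNat
      (Module.length_le_of_surjective (Submodule.factor (Submodule.smul_mono_left
        (Ideal.pow_right_mono hq n))) (Submodule.factor_surjective _))
      (length_quotient_pow_smul_ne_top _ h n)

lemma eventually_eulerChar_koszul_eq (a : Fin t → A) (q : Ideal A)
    (hq : Ideal.span (Set.range a) ≤ q) (c : Fin t → ℕ) (ha : ∀ i, a i ∈ q ^ c i)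
    (h : Module.length A (M ⧸ (Ideal.span (Set.range a) • (⊤ : Submodule A M))) ≠ ⊤)
    {P : Polynomial ℚ} (hP : IsHilbertSamuelPoly q M P) :
    ∀ᶠ n in Filter.atTop, (eulerChar t (genKoszulComplex a q c ha M 0) : ℚ) =
      eulerChar t (genKoszulComplex a q c ha M n) +
        (∏ i, (c i : ℚ)) * (t.factorial * P.coeff t) := by
  obtain ⟨N, hN⟩ := Filter.eventually_atTop.1 hP.eventually_eq
  -- Every exponent `n - c_J` is then untruncated and at least `N`.
  filter_upwards [Filter.eventually_ge_atTop (N + ∑ j, c j)] with n hn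
  have hsum := sum_powerset_eval_sub_sum (fun j => (c j : ℚ)) Finset.univ P
    (by simpa using natDegree_le_of_isHilbertSamuelPoly a h hq hP) n
  rw [Finset.card_univ, Fintype.card_fin, mul_assoc] at hsum
  rw [eulerChar_koszul_eq a q hq c ha h n, ← hsum]
  push_cast
  congr 1
  refine Finset.sum_congr rfl fun J _ => ?_
  have hJ : ∑ j ∈ J, c j ≤ ∑ j, c j :=
    Finset.sum_le_sum_of_subset (Finset.subset_univ J)
  rw [hN _ (by omega), Nat.cast_sub (by omega), Nat.cast_sum]

/-- Serre's formula for the Koszul complex: level `0` depends on neither `q` nor `c`, so one may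
take `q = (a)` and `c = 1`, where `χ(K(n))` eventually vanishes. -/
lemma eulerChar_koszul_eq_multiplicity (a : Fin t → A) (q : Ideal A) (c : Fin t → ℕ)
    (ha : ∀ i, a i ∈ q ^ c i)
    (h : Module.length A (M ⧸ (Ideal.span (Set.range a) • (⊤ : Submodule A M))) ≠ ⊤)
    {P : Polynomial ℚ} (hP : IsHilbertSamuelPoly (Ideal.span (Set.range a)) M P) :
    (eulerChar t (genKoszulComplex a q c ha M 0) : ℚ) = t.factorial * P.coeff t := by
  obtain ⟨n, h1, h2⟩ := ((eventually_eulerChar_koszul_eq a _ le_rfl 1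
    (mem_span_range_pow_one a) h hP).and
    (eventually_eulerChar_genKoszulComplex_span_eq_zero (M := M) a
      (mem_span_range_pow_one a))).exists
  have h0 : eulerChar t (genKoszulComplex a q c ha M 0) = eulerChar t
      (genKoszulComplex a (Ideal.span (Set.range a)) 1 (mem_span_range_pow_one a) M 0) := by
    rw [eulerChar_genKoszulComplex, eulerChar_genKoszulComplex,
      show genKoszulX q c M 0 = genKoszulX (Ideal.span (Set.range a)) 1 M 0 from
        funext fun i => by rw [genKoszulX_zero, genKoszulX_zero]]
  rw [h0, h1, h2]
  simp

end EulerCharacteristic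

end GenKoszul

theorem mainTheorem4 {A : Type*} [CommRing A] [IsNoetherianRing A] [IsLocalRing A]
    {M : Type*} [AddCommGroup M] [Module A M] [Module.Finite A M]
    {d : ℕ} (a : Fin d → A) (hsop : GenKoszul.IsSystemOfParameters a M)
    (q : Ideal A) (hq : Ideal.span (Set.range a) ≤ q)
    (c : Fin d → ℕ) (ha : ∀ i, a i ∈ q ^ c i) :
    GenKoszul.IsHilbertSamuelPoly (Ideal.span (Set.range a)) M
        (GenKoszul.hilbertSamuelPoly (Ideal.span (Set.range a)) M) ∧
      GenKoszul.IsHilbertSamuelPoly q M (GenKoszul.hilbertSamuelPoly q M) ∧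
      (∀ (n i : ℕ), IsFiniteLength A
        ((GenKoszul.genKoszulComplex a q c ha M n).homology i)) ∧
      (∀ᶠ n : ℕ in Filter.atTop,
        GenKoszul.multiplicity (Ideal.span (Set.range a)) M =
          (∏ i, (c i : ℚ)) * GenKoszul.multiplicity q M +
            (GenKoszul.eulerChar d (GenKoszul.genKoszulComplex a q c ha M n) : ℚ)) ∧
      (∃ χ : ℤ, ∀ᶠ n : ℕ in Filter.atTop,
        GenKoszul.eulerChar d (GenKoszul.genKoszulComplex a q c ha M n) = χ) := by
  have h := Module.length_ne_top_iff.2 hsop.finite_length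
  have hPa := GenKoszul.isHilbertSamuelPoly_hilbertSamuelPoly _ h
  have hPq := GenKoszul.isHilbertSamuelPoly_hilbertSamuelPoly q
    (GenKoszul.length_quotient_ne_top_of_le (Submodule.smul_mono_left hq) h)
  -- Matches the coefficient read off by `multiplicity` with the number of parameters.
  have hdim : ((Module.supportDim A M).unbotD 0).toNat = d := by
    rw [hsop.dim_eq]
    rfl
  have hev : ∀ᶠ n : ℕ in Filter.atTop, GenKoszul.multiplicity (Ideal.span (Set.range a)) M =
      (∏ i, (c i : ℚ)) * GenKoszul.multiplicity q M +
        (GenKoszul.eulerChar d (GenKoszul.genKoszulComplex a q c ha M n) : ℚ) := by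
    filter_upwards [GenKoszul.eventually_eulerChar_koszul_eq a q hq c ha h hPq] with n hn
    rw [GenKoszul.multiplicity, GenKoszul.multiplicity, hdim,
      ← GenKoszul.eulerChar_koszul_eq_multiplicity a q c ha h hPa, hn, add_comm]
  refine ⟨hPa, hPq, GenKoszul.isFiniteLength_homology_genKoszulComplex a q c ha h, hev, ?_⟩
  obtain ⟨N, hN⟩ := Filter.eventually_atTop.1 hev
  refine ⟨GenKoszul.eulerChar d (GenKoszul.genKoszulComplex a q c ha M N), ?_⟩
  filter_upwards [Filter.eventually_ge_atTop N] with n hn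
  exact_mod_cast add_left_cancel ((hN n hn).symm.trans (hN N le_rfl))
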